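/- Let $p\ge 5$ be a prime and let $d\ge 0$ be an integer. An ideal $I$ of a $\mathbb{Z}_p$-algebra $A$ is called $p$-reduced if it is proper and, for every $x\in A$, $px\in I$ implies $x\in I$. Let $I$ and $J$ be two $p$-reduced ideals of $\mathbb{Z}_p[x_1,\ldots,x_d]$ with $I\cap\mathbb{Z}_p=J\cap\mathbb{Z}_p=(0)$, and let $\sigma$ be a $\mathbb{Z}_p$-algebra automorphism of $\mathbb{Z}_p[x_1,\ldots,x_d]$. Then the set $$\{m\in\mathbb{Z} : \sigma^m(I)\supseteq J\},\qquad\text{where } \sigma^m(I)=\{\sigma^m(f): f\in I\},$$ is the union of finitely many (possibly zero) complete doubly-infinite arithmetic progressions $\{an+b : n\in\mathbb{Z}\}$ ($a,b\in\mathbb{Z}$, $a\neq 0$) and a finite (possibly empty) set. -/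

import Mathlib

/-- A proper ideal `I` of a `ℤ_p`-algebra `A` is `p`-reduced if `p x ∈ I` implies `x ∈ I`. -/
def IsPReduced (p : ℕ) [Fact p.Prime] {A : Type*} [CommRing A] [Algebra ℤ_[p] A]
    (I : Ideal A) : Prop :=
  I ≠ ⊤ ∧ ∀ x : A, (p : ℤ_[p]) • x ∈ I → x ∈ I

/-- A complete doubly-infinite arithmetic progression `{a n + b : n ∈ ℤ}` with `a ≠ 0`. -/
def IsCompleteArithProg (P : Set ℤ) : Prop :=
  ∃ a b : ℤ, a ≠ 0 ∧ P = {m : ℤ | ∃ n : ℤ, m = a * n + b}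

/-- `S` is the union of finitely many (possibly zero) complete doubly-infinite arithmetic
progressions and a finite (possibly empty) set. -/
def HasTwoSidedSML (S : Set ℤ) : Prop :=
  ∃ (C : Set (Set ℤ)) (F : Set ℤ), C.Finite ∧ (∀ P ∈ C, IsCompleteArithProg P) ∧
    F.Finite ∧ S = ⋃₀ C ∪ F

open Polynomial in
/-- A function on `ℕ` given by a rapidly decreasing `q`-adic Newton series that has `M` zeros
is everywhere of size at most `C * q ^ (-M)`. -/
theorem norm_newton_sum_le (q : ℕ) [Fact q.Prime] (c : ℕ → ℚ_[q]) (C : ℝ)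
    (hc : ∀ i, ‖c i‖ ≤ C * ((q : ℝ)⁻¹) ^ (2 * i)) (T : Finset ℕ)
    (hT : ∀ t ∈ T, ∑ i ∈ Finset.range (t + 1), (t.choose i : ℚ_[q]) * c i = 0) (n : ℕ) :
    ‖∑ i ∈ Finset.range (n + 1), (n.choose i : ℚ_[q]) * c i‖ ≤ C * ((q : ℝ)⁻¹) ^ T.card := by
  classical
  have hq0 : (0 : ℝ) < q := by exact_mod_cast (Fact.out : q.Prime).pos
  have hq1 : (q : ℝ)⁻¹ ≤ 1 := inv_le_one_of_one_le₀ (by exact_mod_cast (Fact.out : q.Prime).one_le)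
  have hC : 0 ≤ C := by simpa using (norm_nonneg _).trans (hc 0)
  obtain ⟨K, hK, hnK⟩ : ∃ K, (∀ t ∈ T, t ≤ K) ∧ n ≤ K :=
    ⟨max (T.sup id) n, fun t ht => le_max_of_le_left (Finset.le_sup (f := id) ht), le_max_right _ _⟩
  set a : ℕ → ℚ_[q] := fun i => c i / (i.factorial : ℚ_[q]) with ha
  have hfac : ∀ i : ℕ, (i.factorial : ℚ_[q]) ≠ 0 := fun i => by
    exact_mod_cast i.factorial_ne_zero
  have hnormfac : ∀ i : ℕ, ((q : ℝ)⁻¹) ^ i ≤ ‖(i.factorial : ℚ_[q])‖ := fun i => by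
    have h1 := Padic.norm_eq_zpow_neg_valuation (hfac i)
    rw [h1, Padic.valuation_natCast, inv_pow, ← zpow_natCast, ← zpow_neg]
    refine zpow_le_zpow_right₀ (by exact_mod_cast (Fact.out : q.Prime).one_le) ?_
    have := padicValNat_factorial_le q i
    omega
  have hanorm : ∀ i, ‖a i‖ ≤ C * ((q : ℝ)⁻¹) ^ i := fun i => by
    rw [ha, norm_div, div_le_iff₀ (norm_pos_iff.2 (hfac i))]
    calc ‖c i‖ ≤ C * ((q : ℝ)⁻¹) ^ (2 * i) := hc i
      _ = C * ((q : ℝ)⁻¹) ^ i * ((q : ℝ)⁻¹) ^ i := by rw [two_mul, pow_add]; ring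
      _ ≤ _ := mul_le_mul_of_nonneg_left (hnormfac i) (by positivity)
  have hterm : ∀ (m i : ℕ), (m.choose i : ℚ_[q]) * c i =
      a i * (((descPochhammer ℤ i).eval (m : ℤ) : ℤ) : ℚ_[q]) := fun m i => by
    rw [descPochhammer_eval_eq_descFactorial, Nat.descFactorial_eq_factorial_mul_choose, ha]
    push_cast
    field_simp [hfac i]
  have hext : ∀ m ≤ K, ∑ i ∈ Finset.range (m + 1), (m.choose i : ℚ_[q]) * c i =
      ∑ i ∈ Finset.range (K + 1), a i * (((descPochhammer ℤ i).eval (m : ℤ) : ℤ) : ℚ_[q]) := by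
    intro m hm
    simp_rw [← hterm]
    refine Finset.sum_subset (Finset.range_mono (by omega)) fun i _ hi => ?_
    rw [Nat.choose_eq_zero_of_lt (by simpa using hi)]
    simp
  set W : ℤ[X] := ∏ t ∈ T, (X - Polynomial.C (t : ℤ)) with hW
  have hmon : W.Monic := monic_prod_of_monic _ _ fun t _ => monic_X_sub_C _
  have hdeg : W.natDegree = T.card := by
    rw [hW, natDegree_prod_of_monic _ _ fun t _ => monic_X_sub_C _]
    simp only [natDegree_X_sub_C, Finset.sum_const, smul_eq_mul, mul_one]
  have hdecomp : ∀ (m i : ℕ), (((descPochhammer ℤ i).eval (m : ℤ) : ℤ) : ℚ_[q]) =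
      ((descPochhammer ℤ i %ₘ W).eval (m : ℤ) : ℤ) +
        (W.eval (m : ℤ) : ℤ) * ((descPochhammer ℤ i /ₘ W).eval (m : ℤ) : ℤ) := fun m i => by
    conv_lhs => rw [← modByMonic_add_div (descPochhammer ℤ i) W]
    push_cast [eval_add, eval_mul]
    rfl
  set r : ℚ_[q][X] := ∑ i ∈ Finset.range (K + 1),
    Polynomial.C (a i) * (descPochhammer ℤ i %ₘ W).map (Int.castRingHom ℚ_[q]) with hr
  have hreval : ∀ m : ℕ, r.eval (m : ℚ_[q]) = ∑ i ∈ Finset.range (K + 1),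
      a i * ((descPochhammer ℤ i %ₘ W).eval (m : ℤ) : ℤ) := fun m => by
    rw [hr, eval_finsetSum]
    refine Finset.sum_congr rfl fun i _ => ?_
    rw [eval_mul, eval_C, ← Int.cast_natCast, eval_intCast_map]
    simp
  have hr0 : r = 0 := by
    refine eq_zero_of_degree_lt_of_eval_finset_eq_zero
      (T.map ⟨((↑) : ℕ → ℚ_[q]), Nat.cast_injective⟩) ?_ ?_
    · rw [Finset.card_map]
      refine (degree_sum_le _ _).trans_lt ?_
      rw [Finset.sup_lt_iff (WithBot.bot_lt_coe _)]
      intro i _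
      rw [C_mul']
      refine (degree_smul_le _ _).trans_lt ?_
      refine degree_map_le.trans_lt ((degree_modByMonic_lt _ hmon).trans_le ?_)
      rw [degree_eq_natDegree hmon.ne_zero, hdeg]
    · intro x hx
      obtain ⟨t, ht, rfl⟩ := Finset.mem_map.1 hx
      have h0 := hT t ht
      rw [hext t (hK t ht)] at h0
      have hz : W.eval (t : ℤ) = 0 := by
        rw [hW, eval_prod]; exact Finset.prod_eq_zero ht (by simp)
      simp_rw [hdecomp, hz] at h0
      simpa [hreval] using h0
  rw [hext n hnK]
  simp_rw [hdecomp, mul_add, Finset.sum_add_distrib, ← hreval, hr0, eval_zero, zero_add]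
  refine IsUltrametricDist.norm_sum_le_of_forall_le_of_nonneg (by positivity) fun i _ => ?_
  by_cases hi : i < T.card
  · rw [(divByMonic_eq_zero_iff hmon).2]
    · simp; positivity
    · rw [degree_eq_natDegree hmon.ne_zero, hdeg]
      refine degree_le_natDegree.trans_lt ?_
      rw [descPochhammer_natDegree]
      exact_mod_cast hi
  · rw [norm_mul, norm_mul]
    calc ‖a i‖ * _ ≤ C * ((q : ℝ)⁻¹) ^ i * (1 * 1) := by
          gcongr
          · exact hanorm i
          · exact Padic.norm_int_le_one _
          · exact Padic.norm_int_le_one _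
      _ ≤ _ := by
        rw [mul_one, mul_one]
        exact mul_le_mul_of_nonneg_left
          (pow_le_pow_of_le_one (by positivity) hq1 (not_lt.1 hi)) hC

section Dynamics

variable {B : Type*} [CommRing B]

/-- An automorphism congruent to the identity modulo `𝔫 ^ 3` moves elements of `𝔫 ^ j` only by
elements of `𝔫 ^ (j + 2)`. -/
theorem sub_mem_pow_add_two (φ : B ≃ₐ[ℤ] B) (𝔫 : Ideal B) (hφ : ∀ b, φ b - b ∈ 𝔫 ^ 3) (j : ℕ) :
    ∀ b ∈ 𝔫 ^ j, φ b - b ∈ 𝔫 ^ (j + 2) := by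
  induction j with
  | zero => exact fun b _ => Ideal.pow_le_pow_right (by norm_num) (hφ b)
  | succ j ih =>
    intro b hb
    rw [pow_succ] at hb
    refine Submodule.mul_induction_on hb (fun x hx y hy => ?_) fun x y hx hy => ?_
    · have hφy : φ y ∈ 𝔫 := by
        have := 𝔫.add_mem (Ideal.pow_le_self (by norm_num) (hφ y)) hy
        simpa using this
      have h1 : (φ x - x) * φ y ∈ 𝔫 ^ (j + 1 + 2) := by
        rw [show j + 1 + 2 = (j + 2) + 1 by ring, pow_succ]
        exact Ideal.mul_mem_mul (ih x hx) hφy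
      have h2 : x * (φ y - y) ∈ 𝔫 ^ (j + 1 + 2) := by
        rw [show j + 1 + 2 = j + 3 by ring, pow_add]
        exact Ideal.mul_mem_mul hx (hφ y)
      have := Ideal.add_mem _ h1 h2
      rw [map_mul]
      convert this using 1
      ring
    · have := Ideal.add_mem _ hx hy
      rw [map_add]
      convert this using 1
      ring

/-- If `ℓ (φ ^ t b)` vanishes for infinitely many integers `t`, then it vanishes for all. -/
theorem eq_zero_of_infinite_zeros (q : ℕ) [Fact q.Prime] (φ : B ≃ₐ[ℤ] B) (𝔫 : Ideal B)
    (hφ : ∀ b, φ b - b ∈ 𝔫 ^ 3) (ℓ : B →+ ℚ_[q]) (k : ℕ) (C : ℝ)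
    (hℓ : ∀ b, ‖ℓ b‖ ≤ C) (hℓ' : ∀ j, ∀ b ∈ 𝔫 ^ (j + k), ‖ℓ b‖ ≤ C * ((q : ℝ)⁻¹) ^ j)
    (b : B) (T : Set ℤ) (hT : T.Infinite) (hT0 : ∀ t ∈ T, ℓ ((φ ^ t) b) = 0) (n : ℤ) :
    ℓ ((φ ^ n) b) = 0 := by
  classical
  have hq0 : (0 : ℝ) < q := by exact_mod_cast (Fact.out : q.Prime).pos
  have hq1 : (q : ℝ)⁻¹ < 1 := inv_lt_one_of_one_lt₀ (by exact_mod_cast (Fact.out : q.Prime).one_lt)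
  have hC : 0 ≤ C := (norm_nonneg _).trans (hℓ 0)
  set δ : Module.End ℤ B := φ.toLinearMap - 1 with hδ
  have hδmem : ∀ (i : ℕ) (x : B), (δ ^ i) x ∈ 𝔫 ^ (2 * i) := by
    intro i x
    induction i with
    | zero => simp
    | succ i ih =>
      rw [pow_succ', Module.End.mul_apply]
      exact sub_mem_pow_add_two φ 𝔫 hφ _ _ ih
  have hexp : ∀ (m : ℕ) (x : B), ℓ ((φ ^ m) x) =
      ∑ i ∈ Finset.range (m + 1), (m.choose i : ℚ_[q]) * ℓ ((δ ^ i) x) := by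
    intro m x
    have h1 : (φ ^ m) x = ((δ + 1) ^ m) x := by
      rw [hδ, sub_add_cancel]
      clear_value δ
      induction m generalizing x with
      | zero => simp
      | succ m ih => rw [pow_succ, pow_succ, Module.End.mul_apply, AlgEquiv.mul_apply, ih]; rfl
    rw [h1, (Commute.one_right δ).add_pow, LinearMap.sum_apply, map_sum]
    refine Finset.sum_congr rfl fun i _ => ?_
    rw [one_pow, mul_one, ← nsmul_eq_mul', LinearMap.smul_apply, map_nsmul, nsmul_eq_mul]
  set C' : ℝ := C * (q : ℝ) ^ k with hC'
  have hbound : ∀ (i : ℕ) (x : B), ‖ℓ ((δ ^ i) x)‖ ≤ C' * ((q : ℝ)⁻¹) ^ (2 * i) := by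
    intro i x
    by_cases h : k ≤ 2 * i
    · obtain ⟨j, hj⟩ := Nat.exists_eq_add_of_le' h
      refine (hℓ' j _ (hj ▸ hδmem i x)).trans (le_of_eq ?_)
      have hk : (q : ℝ) ^ k * ((q : ℝ)⁻¹) ^ k = 1 := by
        rw [← mul_pow, mul_inv_cancel₀ hq0.ne', one_pow]
      rw [hC', hj, pow_add]
      linear_combination (-(C * ((q : ℝ)⁻¹) ^ j)) * hk
    · refine (hℓ _).trans ?_
      rw [hC', mul_assoc]
      refine le_mul_of_one_le_right hC ?_
      obtain ⟨j, hj⟩ := Nat.exists_eq_add_of_le (not_le.1 h).le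
      rw [hj, pow_add, mul_right_comm, ← mul_pow, mul_inv_cancel₀ hq0.ne', one_pow, one_mul]
      exact one_le_pow₀ (by exact_mod_cast (Fact.out : q.Prime).one_le)
  have hle : ∀ M : ℕ, ‖ℓ ((φ ^ n) b)‖ ≤ C' * ((q : ℝ)⁻¹) ^ M := by
    intro M
    obtain ⟨F, hFT, hFM⟩ := hT.exists_subset_card_eq M
    obtain ⟨s, hs⟩ : ∃ s : ℤ, ∀ t ∈ insert n F, -s ≤ t := by
      obtain ⟨m, hm⟩ := (insert n F).bddBelow
      exact ⟨-m, fun t ht => by simpa using hm ht⟩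
    have key : ∀ t : ℤ, -s ≤ t → (φ ^ t) b = (φ ^ (t + s).toNat) ((φ ^ (-s)) b) := by
      intro t ht
      rw [← AlgEquiv.mul_apply, ← zpow_natCast, ← zpow_add, Int.toNat_of_nonneg (by omega)]
      simp
    have := norm_newton_sum_le q (fun i => ℓ ((δ ^ i) ((φ ^ (-s)) b))) C'
      (fun i => hbound i _) (F.image fun t => (t + s).toNat) (by
        intro u hu
        obtain ⟨t, ht, rfl⟩ := Finset.mem_image.1 hu
        rw [← hexp, ← key t (hs t (Finset.mem_insert_of_mem ht))]
        exact hT0 t (hFT ht)) (n + s).toNat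
    rw [← hexp, ← key n (hs n (Finset.mem_insert_self _ _)), Finset.card_image_of_injOn, hFM] at this
    · exact this
    · intro t ht t' ht' h
      have h1 := hs t (Finset.mem_insert_of_mem ht)
      have h2 := hs t' (Finset.mem_insert_of_mem ht')
      simp only at h
      omega
  rw [← norm_le_zero_iff]
  refine ge_of_tendsto' (x := Filter.atTop) ?_ hle
  simpa using (tendsto_pow_atTop_nhds_zero_of_lt_one (by positivity) hq1).const_mul C'

/-- Every automorphism of a finitely generated ring has a positive power inducing the identity
on a given finite quotient. -/
theorem exists_pow_sub_mem (X : Set B) (hX : X.Finite) (hgen : Algebra.adjoin ℤ X = ⊤)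
    (τ : B ≃ₐ[ℤ] B) (𝔞 : Ideal B) [Finite (B ⧸ 𝔞)] :
    ∃ N : ℕ, 0 < N ∧ ∀ b, (τ ^ N) b - b ∈ 𝔞 := by
  have := hX.to_subtype
  obtain ⟨i, j, hij, h⟩ := Finite.exists_ne_map_eq_of_infinite
    (fun (n : ℕ) (x : X) => Ideal.Quotient.mk 𝔞 ((τ ^ n) x))
  wlog hlt : i < j generalizing i j
  · exact this j i hij.symm h.symm (by omega)
  have hall : ((Ideal.Quotient.mkₐ ℤ 𝔞).comp (τ ^ i).toAlgHom) =
      (Ideal.Quotient.mkₐ ℤ 𝔞).comp (τ ^ j).toAlgHom :=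
    AlgHom.ext_of_adjoin_eq_top hgen fun x hx => congrFun h ⟨x, hx⟩
  refine ⟨j - i, by omega, fun b => ?_⟩
  have hb := DFunLike.congr_fun hall ((τ ^ i)⁻¹ b)
  rw [eq_comm] at hb
  have h2 := Ideal.Quotient.eq.1 hb
  have e : (τ ^ (j - i)) b = (τ ^ j) ((τ ^ i)⁻¹ b) := by
    rw [← AlgEquiv.mul_apply, pow_sub _ hlt.le]
  have e' : (τ ^ i) ((τ ^ i)⁻¹ b) = b := by
    rw [← AlgEquiv.mul_apply, mul_inv_cancel]; rfl
  rw [e]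
  conv => enter [2, 2]; rw [← e']
  exact h2

end Dynamics

section Lattice

variable {B : Type*} [CommRing B] (q : ℕ) [Fact q.Prime]

/-- The subring of `q`-integral rational numbers. -/
noncomputable def qIntegralRationals : Subring ℚ := (PadicInt.subring q).comap (algebraMap ℚ ℚ_[q])

theorem mem_qIntegralRationals {r : ℚ} : r ∈ qIntegralRationals q ↔ ‖(r : ℚ_[q])‖ ≤ 1 := by
  simp [qIntegralRationals, Subring.mem_comap, PadicInt.mem_subring_iff]

/-- A linear functional on a `ℚ`-algebra is `q`-adically bounded on any subring generated by
finitely many elements that are integral over the `q`-integral rationals. -/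
theorem exists_norm_le_of_isIntegral {W : Type*} [CommRing W] [Algebra ℚ W] (κ : B →ₐ[ℤ] W)
    (X : Set B) (hX : X.Finite) (hgen : Algebra.adjoin ℤ X = ⊤)
    (hint : ∀ x ∈ X, IsIntegral (qIntegralRationals q) (κ x)) (ℓ : W →ₗ[ℚ] ℚ) :
    ∃ C : ℝ, ∀ b, ‖((ℓ (κ b) : ℚ) : ℚ_[q])‖ ≤ C := by
  obtain ⟨S, hS⟩ := fg_adjoin_of_finite (R := qIntegralRationals q) (hX.image κ)
    (by rintro _ ⟨x, hx, rfl⟩; exact hint x hx)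
  have hmem : ∀ b, κ b ∈ Submodule.span (qIntegralRationals q) (S : Set W) := by
    intro b
    rw [hS, Subalgebra.mem_toSubmodule]
    have hb : b ∈ Algebra.adjoin ℤ X := hgen ▸ Algebra.mem_top
    induction hb using Algebra.adjoin_induction with
    | mem x hx => exact Algebra.subset_adjoin ⟨x, hx, rfl⟩
    | algebraMap r => simp
    | add x y _ _ hx hy => rw [map_add]; exact add_mem hx hy
    | mul x y _ _ hx hy => rw [map_mul]; exact mul_mem hx hy
  refine ⟨∑ s ∈ S, ‖((ℓ s : ℚ) : ℚ_[q])‖, fun b => ?_⟩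
  refine Submodule.span_induction (p := fun w _ => ‖((ℓ w : ℚ) : ℚ_[q])‖ ≤ _)
    (fun s hs => ?_) ?_ (fun x y _ _ hx hy => ?_) (fun r x _ hx => ?_) (hmem b)
  · exact Finset.single_le_sum (f := fun s => ‖((ℓ s : ℚ) : ℚ_[q])‖)
      (fun _ _ => norm_nonneg _) hs
  · rw [map_zero, Rat.cast_zero, norm_zero]
    exact Finset.sum_nonneg fun _ _ => norm_nonneg _
  · rw [map_add, Rat.cast_add]
    exact (Padic.nonarchimedean _ _).trans (max_le hx hy)
  · have : ℓ (r • x) = (r : ℚ) * ℓ x := by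
      rw [← smul_eq_mul, ← map_smul]; rfl
    rw [this, Rat.cast_mul, norm_mul]
    have hr := (mem_qIntegralRationals q).1 r.2
    exact (mul_le_of_le_one_left (norm_nonneg _) hr).trans hx

open Polynomial in
/-- A root of an integer polynomial with leading coefficient prime to `q` is integral over the
`q`-integral rationals. -/
theorem isIntegral_of_aeval_eq_zero {W : Type*} [CommRing W] [Algebra ℚ W] (w : W) (P : ℤ[X])
    (hP : ¬ (q : ℤ) ∣ P.leadingCoeff) (h : aeval w P = 0) :
    IsIntegral (qIntegralRationals q) w := by
  have h1 : IsIntegral (qIntegralRationals q) (P.leadingCoeff • w) :=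
    (isIntegral_leadingCoeff_smul P w h).tower_top
  have hnorm : ‖((P.leadingCoeff : ℤ) : ℚ_[q])‖ = 1 := by
    refine le_antisymm (Padic.norm_int_le_one _) (not_lt.1 fun hlt => hP ?_)
    exact Padic.norm_intCast_lt_one_iff.1 hlt
  have h0 : (P.leadingCoeff : ℚ) ≠ 0 := by
    intro h0
    apply hP
    rw [Int.cast_eq_zero.1 h0]
    exact dvd_zero _
  let u : qIntegralRationals q := ⟨(P.leadingCoeff : ℚ)⁻¹, by
    rw [mem_qIntegralRationals]; push_cast; rw [norm_inv, hnorm, inv_one]⟩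
  have h2 := h1.smul u
  have h3 : u • (P.leadingCoeff • w) = w := by
    change (P.leadingCoeff : ℚ)⁻¹ • (P.leadingCoeff • w) = w
    rw [← Int.cast_smul_eq_zsmul ℚ, smul_smul, inv_mul_cancel₀ h0, one_smul]
  rwa [h3] at h2

open Polynomial in
/-- A quotient of characteristic dividing `q`, generated by finitely many roots of integer
polynomials with leading coefficient prime to `q`, is finite. -/
theorem finite_of_map_aeval_eq_zero {B' : Type*} [CommRing B'] (f : B →+* B')
    (hf : Function.Surjective f) (X : Set B) (hX : X.Finite) (hgen : Algebra.adjoin ℤ X = ⊤)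
    (hq : (q : B') = 0)
    (hroot : ∀ x ∈ X, ∃ P : ℤ[X], ¬ (q : ℤ) ∣ P.leadingCoeff ∧ f (aeval x P) = 0) :
    Finite B' := by
  have hint : ∀ x ∈ X, IsIntegral ℤ (f x) := by
    intro x hx
    obtain ⟨P, hP, h⟩ := hroot x hx
    have h1 := isIntegral_leadingCoeff_smul P (f x)
      ((aeval_algHom_apply f.toIntAlgHom x P).trans h)
    obtain ⟨u, v, huv⟩ := ((Nat.prime_iff_prime_int.1 (Fact.out : q.Prime)).coprime_iff_not_dvd.2 hP)
    have h2 : v • (P.leadingCoeff • f x) = f x := by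
      have hq' : ((q : ℤ) : B') = 0 := by exact_mod_cast hq
      have := congrArg (fun z : ℤ => (z : B') * f x) huv
      simp only [Int.cast_add, Int.cast_mul, hq', mul_zero, zero_add, Int.cast_one, one_mul] at this
      rw [smul_smul, zsmul_eq_mul, Int.cast_mul]
      exact this
    rw [← h2]
    exact h1.smul v
  have hfg := fg_adjoin_of_finite (hX.image f)
    (by rintro _ ⟨x, hx, rfl⟩; exact hint x hx)
  have hgen' : Algebra.adjoin ℤ (f '' X) = ⊤ := by
    have := AlgHom.map_adjoin f.toIntAlgHom X
    rw [hgen, Algebra.map_top, (AlgHom.range_eq_top _).2 hf] at this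
    exact this.symm
  rw [hgen', Algebra.top_toSubmodule] at hfg
  have : Module.Finite ℤ B' := ⟨hfg⟩
  refine Module.finite_of_fg_torsion B' fun x => ?_
  refine ⟨⟨(q : ℤ), mem_nonZeroDivisors_of_ne_zero (by exact_mod_cast (Fact.out : q.Prime).ne_zero)⟩, ?_⟩
  change (q : ℤ) • x = 0
  rw [zsmul_eq_mul]
  have hq' : ((q : ℤ) : B') = 0 := by exact_mod_cast hq
  rw [hq', zero_mul]

end Lattice

/-- Krull's intersection theorem for a primary ideal `Q` and a proper ideal containing it. -/
theorem exists_notMem_sup_pow {L : Type*} [CommRing L] [IsNoetherianRing L] (Q m : Ideal L)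
    (hQ : Q.IsPrimary) (hQm : Q ≤ m) (hm : m.IsPrime) (x : L) (hx : x ∉ Q) :
    ∃ k : ℕ, x ∉ Q ⊔ m ^ k := by
  by_contra! h
  have hmem : (Ideal.Quotient.mk Q x) ∈ (⨅ i : ℕ, m ^ i • ⊤ : Submodule L (L ⧸ Q)) := by
    rw [Submodule.mem_iInf]
    intro i
    obtain ⟨a, ha, b, hb, rfl⟩ := Submodule.mem_sup.1 (h i)
    rw [map_add, Ideal.Quotient.eq_zero_iff_mem.2 ha, zero_add]
    have : Ideal.Quotient.mk Q b = b • (1 : L ⧸ Q) := by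
      rw [Algebra.smul_def, mul_one]; rfl
    rw [this]
    exact Submodule.smul_mem_smul hb trivial
  obtain ⟨⟨r, hr⟩, hrx⟩ := (Ideal.mem_iInf_smul_pow_eq_bot_iff m _).1 hmem
  have h1 : x * (1 - r) ∈ Q := by
    rw [← Ideal.Quotient.eq_zero_iff_mem]
    have : Ideal.Quotient.mk Q r * Ideal.Quotient.mk Q x = Ideal.Quotient.mk Q x := hrx
    rw [map_mul, map_sub, map_one]
    linear_combination -this
  rcases (Ideal.isPrimary_iff.1 hQ).2 h1 with h2 | h2
  · exact hx h2
  · have h3 : 1 - r ∈ m := (hm.radical_le_iff.2 hQm) h2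
    exact hm.ne_top ((Ideal.eq_top_iff_one m).2 (by simpa using m.add_mem h3 hr))

open Polynomial in
/-- If `Q` is a primary ideal, then after passing to a power `φ` of `τ`, an element whose
`φ`-orbit meets `Q` infinitely often has its whole orbit in `Q`. -/
theorem exists_pow_orbit_dichotomy {B L : Type*} [CommRing B] [CommRing L] [Algebra ℚ L]
    [Algebra.FiniteType ℚ L] (X : Set B) (hX : X.Finite) (hgen : Algebra.adjoin ℤ X = ⊤)
    (τ : B ≃ₐ[ℤ] B) (ι : B →ₐ[ℤ] L) (Q : Ideal L) (hQ : Q.IsPrimary) :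
    ∃ N : ℕ, 0 < N ∧ ∀ b : B, {t : ℤ | ι (((τ ^ N) ^ t) b) ∈ Q}.Infinite →
      ∀ t : ℤ, ι (((τ ^ N) ^ t) b) ∈ Q := by
  classical
  have : IsNoetherianRing L := Algebra.FiniteType.isNoetherianRing ℚ L
  have : Algebra.FiniteType ℤ B := ⟨⟨hX.toFinset, by simpa using hgen⟩⟩
  have : IsNoetherianRing B := Algebra.FiniteType.isNoetherianRing ℤ B
  obtain ⟨m, hm, hQm⟩ := Ideal.exists_le_maximal Q hQ.1
  let _ := Ideal.Quotient.field m
  have hfin : Module.Finite ℚ (L ⧸ m) := finite_of_finite_type_of_isJacobsonRing ℚ (L ⧸ m)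
  have halg : ∀ b : B, ∃ P : ℤ[X], P ≠ 0 ∧ aeval (ι b) P ∈ m := by
    intro b
    have h1 : IsAlgebraic ℚ (Ideal.Quotient.mk m (ι b)) := Algebra.IsAlgebraic.isAlgebraic _
    obtain ⟨P, hP, h⟩ := (IsFractionRing.isAlgebraic_iff ℤ ℚ (L ⧸ m)).2 h1
    refine ⟨P, hP, ?_⟩
    rw [← Ideal.Quotient.eq_zero_iff_mem, ← h]
    exact (aeval_algHom_apply (Ideal.Quotient.mkₐ ℤ m) (ι b) P).symm
  choose P hP0 hPm using halg
  obtain ⟨q, hqle, hq⟩ := Nat.exists_infinite_primes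
    ((∑ x ∈ hX.toFinset, (P x).leadingCoeff.natAbs) + 1)
  have : Fact q.Prime := ⟨hq⟩
  have hqP : ∀ x ∈ X, ¬ (q : ℤ) ∣ (P x).leadingCoeff := by
    intro x hx hdvd
    have h1 := Nat.le_of_dvd (Int.natAbs_pos.2 (leadingCoeff_ne_zero.2 (hP0 x)))
      (Int.natCast_dvd.1 hdvd)
    have h2 := Finset.single_le_sum (f := fun x => (P x).leadingCoeff.natAbs)
      (fun _ _ => Nat.zero_le _) (hX.mem_toFinset.2 hx)
    omega
  set 𝔫 : Ideal B := Ideal.span {(q : B)} ⊔ m.comap ι with h𝔫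
  have hfinq : Finite (B ⧸ 𝔫) := by
    refine finite_of_map_aeval_eq_zero q (Ideal.Quotient.mk 𝔫) Ideal.Quotient.mk_surjective
      X hX hgen ?_ fun x hx => ⟨P x, hqP x hx, ?_⟩
    · rw [← map_natCast (Ideal.Quotient.mk 𝔫), Ideal.Quotient.eq_zero_iff_mem]
      exact Ideal.mem_sup_left (Ideal.mem_span_singleton_self _)
    · refine Ideal.Quotient.eq_zero_iff_mem.2 (Ideal.mem_sup_right ?_)
      rw [Ideal.mem_comap, ← aeval_algHom_apply]
      exact hPm x
  have : Finite (B ⧸ 𝔫 ^ 3) := Ideal.finite_quotient_pow (IsNoetherian.noetherian 𝔫) 3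
  obtain ⟨N, hN, hφ⟩ := exists_pow_sub_mem X hX hgen τ (𝔫 ^ 3)
  refine ⟨N, hN, fun b hinf n => ?_⟩
  by_contra hn
  obtain ⟨k, hk⟩ := exists_notMem_sup_pow Q m hQ hQm hm.isPrime _ hn
  set W := L ⧸ (Q ⊔ m ^ k) with hW
  let κ : B →ₐ[ℤ] W := (Ideal.Quotient.mkₐ ℤ (Q ⊔ m ^ k)).comp ι
  have hκ : ∀ b, ι b ∈ Q ⊔ m ^ k → κ b = 0 := fun b hb => Ideal.Quotient.eq_zero_iff_mem.2 hb
  have hκn : κ (((τ ^ N) ^ n) b) ≠ 0 := fun h => hk (Ideal.Quotient.eq_zero_iff_mem.1 h)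
  obtain ⟨ℓ, hℓ⟩ : ∃ ℓ : W →ₗ[ℚ] ℚ, ℓ (κ (((τ ^ N) ^ n) b)) ≠ 0 := by
    by_contra! h
    exact hκn ((Module.forall_dual_apply_eq_zero_iff ℚ _).1 h)
  obtain ⟨C, hC⟩ := exists_norm_le_of_isIntegral q κ X hX hgen (fun x hx => by
    refine isIntegral_of_aeval_eq_zero q (κ x) (P x ^ k) ?_ ?_
    · rw [leadingCoeff_pow]
      exact fun h => hqP x hx ((Nat.prime_iff_prime_int.1 hq).dvd_of_dvd_pow h)
    · rw [aeval_algHom_apply, map_pow]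
      refine hκ _ (Ideal.mem_sup_right ?_)
      rw [map_pow, ← aeval_algHom_apply]
      exact Ideal.pow_mem_pow (hPm x) k) ℓ
  let ℓ' : B →+ ℚ_[q] :=
    ((Rat.castHom ℚ_[q]).toAddMonoidHom.comp ℓ.toAddMonoidHom).comp (κ : B →+ W)
  have hℓ' : ∀ b, ℓ' b = ((ℓ (κ b) : ℚ) : ℚ_[q]) := fun _ => rfl
  refine hℓ ?_
  have := eq_zero_of_infinite_zeros q (τ ^ N) 𝔫 hφ ℓ' k C hC ?_ b _ hinf (fun t ht => ?_) n
  · rw [hℓ'] at this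
    exact_mod_cast this
  · intro j x hx
    have hx' := Ideal.sup_pow_add_le_pow_sup_pow hx
    obtain ⟨y, hy, z, hz, rfl⟩ := Submodule.mem_sup.1 hx'
    rw [Ideal.span_singleton_pow, Ideal.mem_span_singleton'] at hy
    obtain ⟨w, rfl⟩ := hy
    have hz0 : κ z = 0 := by
      refine hκ _ (Ideal.mem_sup_right ?_)
      have := Ideal.mem_map_of_mem ι hz
      rw [Ideal.map_pow] at this
      exact Ideal.pow_right_mono Ideal.map_comap_le k this
    have h1 : ℓ' (w * (q : B) ^ j + z) = (q : ℚ_[q]) ^ j * ℓ' w := by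
      have e : κ (w * (q : B) ^ j + z) = (q ^ j : ℕ) • κ w := by
        rw [map_add, hz0, add_zero, map_mul, map_pow, map_natCast, nsmul_eq_mul, mul_comm]
        push_cast
        rfl
      rw [hℓ', hℓ', e, map_nsmul, nsmul_eq_mul]
      push_cast
      rfl
    rw [h1, norm_mul, norm_pow, Padic.norm_p, mul_comm]
    exact mul_le_mul_of_nonneg_right (hC w) (by positivity)
  · rw [hℓ', hκ _ (Ideal.mem_sup_left ht), map_zero, Rat.cast_zero]

section ArithmeticProgressions

/-- For some `N > 0`, each residue class modulo `N` either is contained in `S` or meets `S` in a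
finite set. -/
def IsPeriodicUpToFinite (S : Set ℤ) : Prop :=
  ∃ N : ℕ, 0 < N ∧ ∀ r : ℤ, {t : ℤ | N * t + r ∈ S}.Finite ∨ ∀ t : ℤ, N * t + r ∈ S

theorem isPeriodicUpToFinite_univ : IsPeriodicUpToFinite Set.univ :=
  ⟨1, one_pos, fun _ => Or.inr fun _ => trivial⟩

theorem IsPeriodicUpToFinite.inter {S T : Set ℤ} (hS : IsPeriodicUpToFinite S)
    (hT : IsPeriodicUpToFinite T) : IsPeriodicUpToFinite (S ∩ T) := by
  obtain ⟨M, hM, hS⟩ := hS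
  obtain ⟨N, hN, hT⟩ := hT
  refine ⟨M * N, Nat.mul_pos hM hN, fun r => ?_⟩
  have eM : ∀ t : ℤ, ((M * N : ℕ) : ℤ) * t + r = M * (N * t) + r := fun t => by push_cast; ring
  have eN : ∀ t : ℤ, ((M * N : ℕ) : ℤ) * t + r = N * (M * t) + r := fun t => by push_cast; ring
  rcases hS r with h | h
  · left
    refine (h.preimage (f := fun t : ℤ => (N : ℤ) * t) ?_).subset fun t ht => ?_
    · exact (mul_right_injective₀ (by exact_mod_cast hN.ne')).injOn
    · have := ht.1
      rwa [eM] at this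
  · rcases hT r with h' | h'
    · left
      refine (h'.preimage (f := fun t : ℤ => (M : ℤ) * t) ?_).subset fun t ht => ?_
      · exact (mul_right_injective₀ (by exact_mod_cast hM.ne')).injOn
      · have := ht.2
        rwa [eN] at this
    · right
      exact fun t => ⟨by rw [eM]; exact h _, by rw [eN]; exact h' _⟩

theorem IsPeriodicUpToFinite.biInter {α : Type*} (s : Finset α) (S : α → Set ℤ)
    (hS : ∀ i ∈ s, IsPeriodicUpToFinite (S i)) : IsPeriodicUpToFinite {m | ∀ i ∈ s, m ∈ S i} := by
  classical
  induction s using Finset.induction_on with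
  | empty => simpa using isPeriodicUpToFinite_univ
  | insert a s _ ih =>
    have := (hS a (Finset.mem_insert_self _ _)).inter
      (ih fun i hi => hS i (Finset.mem_insert_of_mem hi))
    convert this using 1
    ext m
    simp

theorem IsPeriodicUpToFinite.hasTwoSidedSML {S : Set ℤ} (hS : IsPeriodicUpToFinite S) :
    HasTwoSidedSML S := by
  classical
  obtain ⟨N, hN, h⟩ := hS
  have hN' : (N : ℤ) ≠ 0 := by exact_mod_cast hN.ne'
  set cls : ℤ → Set ℤ := fun r => {m : ℤ | ∃ t : ℤ, m = N * t + r} with hcls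
  set full : Set ℤ := {r | r ∈ Set.Ico (0 : ℤ) N ∧ ∀ t : ℤ, N * t + r ∈ S} with hfull
  set thin : Set ℤ := {r | r ∈ Set.Ico (0 : ℤ) N ∧ {t : ℤ | N * t + r ∈ S}.Finite} with hthin
  refine ⟨cls '' full, ⋃ r ∈ thin, (fun t : ℤ => N * t + r) '' {t : ℤ | N * t + r ∈ S},
    ((Set.finite_Ico (0 : ℤ) N).subset fun r hr => hr.1).image _, ?_, ?_, ?_⟩
  · rintro _ ⟨r, _, rfl⟩
    exact ⟨N, r, hN', rfl⟩
  · exact ((Set.finite_Ico (0 : ℤ) N).subset fun r hr => hr.1).biUnion fun r hr => hr.2.image _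
  · ext m
    constructor
    · intro hm
      have hr : m % N ∈ Set.Ico (0 : ℤ) N :=
        ⟨Int.emod_nonneg _ hN', Int.emod_lt_of_pos _ (by exact_mod_cast hN)⟩
      have hm' : (N : ℤ) * (m / N) + m % N = m := Int.mul_ediv_add_emod _ _
      rcases h (m % N) with h | h
      · refine Or.inr (Set.mem_biUnion (x := m % N) ⟨hr, h⟩ ⟨m / N, ?_, hm'⟩)
        change (N : ℤ) * (m / N) + m % N ∈ S
        rwa [hm']
      · exact Or.inl ⟨_, ⟨m % N, ⟨hr, h⟩, rfl⟩, m / N, hm'.symm⟩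
    · rintro (⟨_, ⟨r, hr, rfl⟩, t, rfl⟩ | hm)
      · exact hr.2 t
      · obtain ⟨r, _, t, ht, rfl⟩ := Set.mem_iUnion₂.1 hm
        exact ht

end ArithmeticProgressions

section Orbits

/-- The return times of an orbit in a finitely generated ring to the preimage of an ideal in a
`ℚ`-algebra of finite type. -/
theorem isPeriodicUpToFinite_orbit {B L : Type*} [CommRing B] [CommRing L] [Algebra ℚ L]
    [Algebra.FiniteType ℚ L] (X : Set B) (hX : X.Finite) (hgen : Algebra.adjoin ℤ X = ⊤)
    (τ : B ≃ₐ[ℤ] B) (ι : B →ₐ[ℤ] L) (I : Ideal L) (b : B) :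
    IsPeriodicUpToFinite {m : ℤ | ι ((τ ^ m) b) ∈ I} := by
  have : IsNoetherianRing L := Algebra.FiniteType.isNoetherianRing ℚ L
  obtain ⟨s, hs, hprim⟩ := Submodule.isLasker L L I
  have hI : ∀ x, x ∈ I ↔ ∀ Q ∈ s, x ∈ Q := fun x => by
    rw [← hs, Submodule.mem_finsetInf]; rfl
  simp_rw [hI]
  refine IsPeriodicUpToFinite.biInter s (fun Q => {m : ℤ | ι ((τ ^ m) b) ∈ Q}) fun Q hQ => ?_
  obtain ⟨N, hN, h⟩ := exists_pow_orbit_dichotomy X hX hgen τ ι Q (hprim hQ)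
  refine ⟨N, hN, fun r => ?_⟩
  have e : ∀ t : ℤ, (τ ^ (N * t + r)) b = ((τ ^ N) ^ t) ((τ ^ r) b) := fun t => by
    rw [zpow_add, zpow_mul, zpow_natCast]; rfl
  have hr := h ((τ ^ r) b)
  simp_rw [← e] at hr
  exact (Set.finite_or_infinite _).imp_right hr

open TensorProduct in
attribute [local instance] Algebra.TensorProduct.rightAlgebra in
/-- The return times of an orbit in a finitely generated ring to an ideal with torsion-free
quotient. -/
theorem isPeriodicUpToFinite_orbit_of_torsionFree {B : Type*} [CommRing B] (X : Set B)
    (hX : X.Finite) (hgen : Algebra.adjoin ℤ X = ⊤) (τ : B ≃ₐ[ℤ] B) (I : Ideal B)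
    (hI : ∀ n : ℤ, n ≠ 0 → ∀ x, (n : B) * x ∈ I → x ∈ I) (b : B) :
    IsPeriodicUpToFinite {m : ℤ | (τ ^ m) b ∈ I} := by
  have : Algebra.FiniteType ℤ B := ⟨⟨hX.toFinset, by simpa using hgen⟩⟩
  have hft : Algebra.FiniteType ℚ (ℚ ⊗[ℤ] B) := inferInstance
  have hloc : IsLocalization (Algebra.algebraMapSubmonoid B (nonZeroDivisors ℤ)) (ℚ ⊗[ℤ] B) :=
    inferInstance
  have hmem : ∀ x, x ∈ I ↔
      (Algebra.TensorProduct.includeRight : B →ₐ[ℤ] ℚ ⊗[ℤ] B) x ∈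
        I.map (algebraMap B (ℚ ⊗[ℤ] B)) := fun x => by
    refine Iff.trans ?_ (IsLocalization.algebraMap_mem_map_algebraMap_iff
      (Algebra.algebraMapSubmonoid B (nonZeroDivisors ℤ)) (ℚ ⊗[ℤ] B) I x).symm
    refine ⟨fun h => ⟨1, one_mem _, by simpa using h⟩, ?_⟩
    rintro ⟨_, ⟨n, hn, rfl⟩, h⟩
    exact hI n (nonZeroDivisors.ne_zero hn) x (by simpa using h)
  simp_rw [hmem]
  exact isPeriodicUpToFinite_orbit X hX hgen τ _ _ b

end Orbits

section Polynomials

open MvPolynomial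

variable {n R : Type*} [CommRing R]

theorem MvPolynomial.mem_subalgebra_of_coeffs (B : Subalgebra ℤ (MvPolynomial n R))
    (hXB : ∀ i, (X i : MvPolynomial n R) ∈ B) (f : MvPolynomial n R)
    (hf : ∀ c ∈ f.coeffs, C c ∈ B) : f ∈ B := by
  rw [f.as_sum]
  refine sum_mem fun s hs => ?_
  rw [monomial_eq]
  exact mul_mem (hf _ (coeff_mem_coeffs _ (mem_support_iff.1 hs)))
    (prod_mem fun i _ => pow_mem (hXB i) _)

/-- The return times of an orbit of polynomials to an ideal with torsion-free quotient. -/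
theorem MvPolynomial.isPeriodicUpToFinite_orbit [Finite n]
    (τ : MvPolynomial n R ≃ₐ[R] MvPolynomial n R) (I : Ideal (MvPolynomial n R))
    (hI : ∀ k : ℤ, k ≠ 0 → ∀ x, (k : MvPolynomial n R) * x ∈ I → x ∈ I) (g : MvPolynomial n R) :
    IsPeriodicUpToFinite {m : ℤ | (τ ^ m) g ∈ I} := by
  set S : Set (MvPolynomial n R) := Set.range X ∪
    ((⋃ i, C '' ((τ (X i)).coeffs : Set R)) ∪ (⋃ i, C '' ((τ⁻¹ (X i)).coeffs : Set R)) ∪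
      C '' (g.coeffs : Set R)) with hS
  have hSfin : S.Finite := by
    refine (Set.finite_range _).union (((Set.finite_iUnion fun i => ?_).union
      (Set.finite_iUnion fun i => ?_)).union ?_) <;>
    exact (Finset.finite_toSet _).image _
  set B := Algebra.adjoin ℤ S with hB
  have hSB : S ⊆ B := Algebra.subset_adjoin
  have hXB : ∀ i, (X i : MvPolynomial n R) ∈ B := fun i => hSB (Or.inl ⟨i, rfl⟩)
  have hgB : g ∈ B := mem_subalgebra_of_coeffs B hXB g fun c hc =>
    hSB (Or.inr (Or.inr ⟨c, hc, rfl⟩))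
  have hstab : ∀ ρ : MvPolynomial n R ≃ₐ[R] MvPolynomial n R, (∀ i, ρ (X i) ∈ B) →
      ∀ b ∈ B, ρ b ∈ B := by
    intro ρ hρ b hb
    have hC : ∀ s : Set R, ∀ x ∈ C '' s, x ∈ B → ρ x ∈ B := by
      rintro s _ ⟨c, _, rfl⟩ h
      rwa [← algebraMap_eq, ρ.commutes]
    induction hb using Algebra.adjoin_induction with
    | mem x hx =>
      have hxB := hSB hx
      rcases hx with ⟨i, rfl⟩ | (hx | hx) | hx
      · exact hρ i
      · obtain ⟨i, hx⟩ := Set.mem_iUnion.1 hx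
        exact hC _ x hx hxB
      · obtain ⟨i, hx⟩ := Set.mem_iUnion.1 hx
        exact hC _ x hx hxB
      · exact hC _ x hx hxB
    | algebraMap r => simp
    | add x y _ _ hx hy => rw [map_add]; exact add_mem hx hy
    | mul x y _ _ hx hy => rw [map_mul]; exact mul_mem hx hy
  have h1 : ∀ b ∈ B, τ b ∈ B := hstab τ fun i => mem_subalgebra_of_coeffs B hXB _ fun c hc =>
    hSB (Or.inr (Or.inl (Or.inl (Set.mem_iUnion.2 ⟨i, c, hc, rfl⟩))))
  have h2 : ∀ b ∈ B, τ⁻¹ b ∈ B := hstab τ⁻¹ fun i => mem_subalgebra_of_coeffs B hXB _ fun c hc =>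
    hSB (Or.inr (Or.inl (Or.inr (Set.mem_iUnion.2 ⟨i, c, hc, rfl⟩))))
  let τB : B ≃ₐ[ℤ] B := AlgEquiv.ofAlgHom
    ((((τ.restrictScalars ℤ).toAlgHom).comp B.val).codRestrict B fun b => h1 b b.2)
    (((((τ⁻¹).restrictScalars ℤ).toAlgHom).comp B.val).codRestrict B fun b => h2 b b.2)
    (AlgHom.ext fun b => Subtype.ext (τ.apply_symm_apply b))
    (AlgHom.ext fun b => Subtype.ext (τ.symm_apply_apply b))
  have hpow : ∀ (k : ℕ) (b : B), (((τB ^ k) b : B) : MvPolynomial n R) = (τ ^ k) b := by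
    intro k
    induction k with
    | zero => exact fun b => rfl
    | succ k ih =>
      intro b
      rw [pow_succ, pow_succ, AlgEquiv.mul_apply, AlgEquiv.mul_apply, ih]
      rfl
  have hzpow : ∀ (m : ℤ) (b : B), (((τB ^ m) b : B) : MvPolynomial n R) = (τ ^ m) b := by
    intro m b
    obtain ⟨k, rfl | rfl⟩ := m.eq_nat_or_neg
    · simpa using hpow k b
    · apply (τ ^ k).injective
      rw [← hpow, ← AlgEquiv.mul_apply, ← AlgEquiv.mul_apply, ← zpow_natCast, ← zpow_natCast,
        ← zpow_add, ← zpow_add]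
      simp
  have horbit : ∀ m : ℤ, (τ ^ m) g = ((τB ^ m) ⟨g, hgB⟩ : B) := fun m => (hzpow m ⟨g, hgB⟩).symm
  simp_rw [horbit]
  exact isPeriodicUpToFinite_orbit_of_torsionFree (Subtype.val ⁻¹' S : Set B)
    (hSfin.preimage Subtype.val_injective.injOn) Algebra.adjoin_adjoin_coe_preimage τB
    (I.comap B.val) (fun k hk x hx => hI k hk x (by simpa using hx)) ⟨g, hgB⟩

end Polynomials

/-- The quotient by a `p`-reduced ideal is torsion-free. -/
theorem IsPReduced.mem_of_intCast_mul_mem {p : ℕ} [Fact p.Prime] {A : Type*} [CommRing A]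
    [Algebra ℤ_[p] A] {I : Ideal A} (hI : IsPReduced p I) {k : ℤ} (hk : k ≠ 0) {x : A}
    (hx : (k : A) * x ∈ I) : x ∈ I := by
  have hk' : (k : ℤ_[p]) ≠ 0 := by exact_mod_cast hk
  have hpow : ∀ (v : ℕ), (p : ℤ_[p]) ^ v • x ∈ I → x ∈ I := by
    intro v
    induction v with
    | zero => simp
    | succ v ih =>
      intro h
      rw [pow_succ', mul_smul] at h
      exact ih (hI.2 _ h)
  refine hpow (k : ℤ_[p]).valuation ?_
  have h1 : (k : A) * x = (PadicInt.unitCoeff hk' : ℤ_[p]) •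
      ((p : ℤ_[p]) ^ (k : ℤ_[p]).valuation • x) := by
    rw [smul_smul, ← PadicInt.unitCoeff_spec hk', Algebra.smul_def, map_intCast]
  rw [h1] at hx
  have h2 := I.smul_of_tower_mem (((PadicInt.unitCoeff hk')⁻¹ : ℤ_[p]ˣ) : ℤ_[p]) hx
  rwa [smul_smul, Units.inv_mul, one_smul] at h2

theorem theorem4p4 (p : ℕ) [Fact p.Prime] (hp : 5 ≤ p) (d : ℕ)
    (I J : Ideal (MvPolynomial (Fin d) ℤ_[p]))
    (hI : IsPReduced p I) (hJ : IsPReduced p J)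
    (hI0 : I.comap (algebraMap ℤ_[p] (MvPolynomial (Fin d) ℤ_[p])) = ⊥)
    (hJ0 : J.comap (algebraMap ℤ_[p] (MvPolynomial (Fin d) ℤ_[p])) = ⊥)
    (σ : MvPolynomial (Fin d) ℤ_[p] ≃ₐ[ℤ_[p]] MvPolynomial (Fin d) ℤ_[p]) :
    HasTwoSidedSML
      {m : ℤ | (J : Set (MvPolynomial (Fin d) ℤ_[p])) ⊆
        ⇑(σ ^ m) '' (I : Set (MvPolynomial (Fin d) ℤ_[p]))} := by
  obtain ⟨G, hG⟩ := (IsNoetherian.noetherian J : J.FG)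
  have himage : ∀ (m : ℤ) f, f ∈ ⇑(σ ^ m) '' (I : Set (MvPolynomial (Fin d) ℤ_[p])) ↔
      (σ⁻¹ ^ m) f ∈ I := by
    intro m f
    rw [inv_zpow]
    constructor
    · rintro ⟨x, hx, rfl⟩
      rwa [← AlgEquiv.mul_apply, inv_mul_cancel]
    · intro h
      refine ⟨_, h, ?_⟩
      rw [← AlgEquiv.mul_apply, mul_inv_cancel]
      rfl
  have hset : {m : ℤ | (J : Set (MvPolynomial (Fin d) ℤ_[p])) ⊆
      ⇑(σ ^ m) '' (I : Set (MvPolynomial (Fin d) ℤ_[p]))} =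
      {m | ∀ g ∈ G, m ∈ {m : ℤ | (σ⁻¹ ^ m) g ∈ I}} := by
    ext m
    constructor
    · intro h g hg
      exact (himage m g).1 (h (hG ▸ Submodule.subset_span hg))
    · intro h f hf
      have hle : J ≤ I.comap (σ⁻¹ ^ m) := by
        rw [← hG]
        exact Submodule.span_le.2 h
      exact (himage m f).2 (hle hf)
  rw [hset]
  exact (IsPeriodicUpToFinite.biInter G _ fun g _ => MvPolynomial.isPeriodicUpToFinite_orbit _ I
    (fun k hk x hx => hI.mem_of_intCast_mul_mem hk hx) g).hasTwoSidedSML
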